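/- Let $X$ be a complex Fréchet space (a complete metrizable locally convex space), $m\ge 1$, and let $M:X^m\to X$ be a continuous $m$-linear operator. For $x=(x_{1-m},\dots,x_0)\in X^m$ define $x_n=M(x_{n-m},\dots,x_{n-1})$ for $n\ge 1$ and write $M^n(x)=x_n$. The orbit of $x$ is $\{x_n : n\ge 1-m\}$; $x$ is a hypercyclic vector for $M$ if its orbit is dense in $X$, and $M$ is hypercyclic if it has a hypercyclic vector. $M$ is strongly transitive if for all nonempty open sets $U\subseteq X^m$ and $V\subseteq X$ there is $n\ge 1$ with $M^n(U)\cap V\neq\emptyset$. **Theorem.** Let $H(\mathbb C)$ be the space of entire functions with the topology of uniform convergence on compact sets, and let $M$ be the continuous bilinear operator $M(f,g)=f(0)\,g'$ on $H(\mathbb C)$. Then $M$ is hypercyclic and $M$ is not strongly transitive. Moreover the set of hypercyclic vectors of $M$ is not residual in $H(\mathbb C)\times H(\mathbb C)$. Consequently the following question has a negative answer: if $X$ is a Fréchet space and $M$ is a hypercyclic multilinear operator on $X$, is the set of hypercyclic vectors of $M$ necessarily residual in $X^m$? -/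

import Mathlib

open Filter Topology

/-- The space `H(ℂ)` of entire functions: the complex subspace of `C(ℂ, ℂ)` of the complex
differentiable functions. As a subspace it carries the topology (and the uniform structure) of
uniform convergence on compact sets. -/
def EntireFunctions : Submodule ℂ C(ℂ, ℂ) where
  carrier := {f | Differentiable ℂ f}
  add_mem' hf hg := Differentiable.add hf hg
  zero_mem' := differentiable_const (0 : ℂ)
  smul_mem' c _ hf := Differentiable.const_smul hf c

namespace EntireFunctions

/-- The derivative of an entire function, as an entire function. -/
noncomputable def derivative (g : EntireFunctions) : EntireFunctions :=
  ⟨⟨deriv (g : C(ℂ, ℂ)), (Differentiable.deriv g.2).continuous⟩, Differentiable.deriv g.2⟩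

theorem derivative_apply (g : EntireFunctions) (z : ℂ) :
    (derivative g : C(ℂ, ℂ)) z = deriv (g : C(ℂ, ℂ)) z := rfl

theorem derivative_add (g h : EntireFunctions) :
    derivative (g + h) = derivative g + derivative h := by
  ext z
  exact deriv_add (g.2 z) (h.2 z)

theorem derivative_smul (c : ℂ) (g : EntireFunctions) :
    derivative (c • g) = c • derivative g := by
  ext z
  exact deriv_const_smul c (g.2 z)

theorem continuous_derivative : Continuous derivative := by
  rw [continuous_iff_continuousAt]
  intro g
  rw [ContinuousAt, tendsto_subtype_rng, ContinuousMap.tendsto_iff_tendstoLocallyUniformly,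
    ← tendstoLocallyUniformlyOn_univ]
  have h : Tendsto (fun f : EntireFunctions => (f : C(ℂ, ℂ))) (𝓝 g) (𝓝 (g : C(ℂ, ℂ))) :=
    continuous_subtype_val.continuousAt
  rw [ContinuousMap.tendsto_iff_tendstoLocallyUniformly, ← tendstoLocallyUniformlyOn_univ] at h
  exact h.deriv (Eventually.of_forall fun f => f.2.differentiableOn) isOpen_univ

/-- The bilinear operator `M(f, g) = f(0) g'` on `H(ℂ)`, a continuous bilinear map; the first
argument is `f = v 0` and the second one is `g = v 1`. -/
noncomputable def evalMulDeriv : EntireFunctions [×2]→L[ℂ] EntireFunctions where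
  toFun v := (v 0 : C(ℂ, ℂ)) 0 • derivative (v 1)
  map_update_add' v i x y := by
    fin_cases i <;>
      simp [Function.update, add_smul, smul_add, derivative_add]
  map_update_smul' v i c x := by
    fin_cases i <;>
      simp [Function.update, mul_smul, derivative_smul, smul_comm c]
  cont := by
    have h0 : Continuous fun v : Fin 2 → EntireFunctions => (v 0 : C(ℂ, ℂ)) 0 :=
      (continuous_eval_const (F := C(ℂ, ℂ)) (0 : ℂ)).comp
        (continuous_subtype_val.comp (continuous_apply 0))
    exact h0.smul (continuous_derivative.comp (continuous_apply 1))

theorem evalMulDeriv_apply (f g : EntireFunctions) (z : ℂ) :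
    (evalMulDeriv ![f, g] : C(ℂ, ℂ)) z = (f : C(ℂ, ℂ)) 0 * deriv (g : C(ℂ, ℂ)) z := rfl

end EntireFunctions

section MultilinearDynamics

variable {X : Type*} [AddCommMonoid X] [Module ℂ X] [TopologicalSpace X] {m : ℕ}

/-- The sequence generated by an `m`-linear operator `M` from the initial conditions
`x = (x_{1-m}, …, x_0)`: its first `m` terms are the initial conditions, and each later term is
the value of `M` at the `m` terms just before it. The term with index `k` here is
`x_{k + 1 - m}` in the usual numbering. -/
def orbitSeq (M : X [×m]→L[ℂ] X) (x : Fin m → X) (k : ℕ) : X :=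
  if h : k < m then x ⟨k, h⟩ else M fun i => orbitSeq M x (k - m + i)
termination_by k
decreasing_by omega

/-- The iterate `M^n (x_{1-m}, …, x_0) = x_n`, for `n ≥ 1` and `m ≥ 1`. -/
def multilinearIterate (M : X [×m]→L[ℂ] X) (n : ℕ) (x : Fin m → X) : X :=
  orbitSeq M x (n + m - 1)

/-- `x` is a hypercyclic vector for `M`: the orbit of `M` with initial conditions `x` is dense. -/
def IsHypercyclicVector (M : X [×m]→L[ℂ] X) (x : Fin m → X) : Prop :=
  Dense (Set.range (orbitSeq M x))

/-- `M` is hypercyclic: it has a hypercyclic vector. -/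
def IsHypercyclic (M : X [×m]→L[ℂ] X) : Prop :=
  ∃ x : Fin m → X, IsHypercyclicVector M x

/-- `M` is strongly transitive: the family `M^n : X^m → X`, `n ≥ 1`, is transitive. -/
def IsStronglyTransitive (M : X [×m]→L[ℂ] X) : Prop :=
  ∀ (U : Set (Fin m → X)) (V : Set X), IsOpen U → U.Nonempty → IsOpen V → V.Nonempty →
    ∃ n : ℕ, 1 ≤ n ∧ (multilinearIterate M n '' U ∩ V).Nonempty

end MultilinearDynamics

/-- Every hypercyclic multilinear operator on a (complex) Fréchet space, that is, on a complete
metrizable locally convex space, has a residual set of hypercyclic vectors. -/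
def HypercyclicImpliesResidual : Prop :=
  ∀ (X : Type) [AddCommGroup X] [Module ℂ X] [UniformSpace X] [IsUniformAddGroup X]
    [ContinuousSMul ℂ X] [LocallyConvexSpace ℝ X] [TopologicalSpace.MetrizableSpace X]
    [CompleteSpace X] (m : ℕ) (M : X [×m]→L[ℂ] X),
    1 ≤ m → IsHypercyclic M → {x | IsHypercyclicVector M x} ∈ residual (Fin m → X)

/-! The iterates are M^n(f, g) = c_n g^{(n)}, where c_0 = 1, c_1 = f(0) and c_{n+2} = c_n a_n
c_{n+1} with a_n = g^{(n)}(0). This recursion is superlinear: small data collapse, while large data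
explode.

Collapse: if |f(0)| < 1/2 and |g| < 1/3 on the closed unit disc, Cauchy's estimates give |c_n| ≤
1/(n+1)!, so every orbit element has modulus at most 1/2 at 0. This open set of pairs never reaches
{|h(0)| > 1/2}. That refutes strong transitivity and, by Baire, residuality
(`norm_orbitSeq_apply_zero_le`).

Explosion: take f = 1 and build the a_n in stages (`Stage.exists_extends`). While a_n is a constant
tail, |c_n| tends to infinity. Once c_N is huge, tiny entries b_j / c_N suffice to give c_N g^{(N)}
the Taylor coefficients b_j, up to a small remainder. One extra entry just before the block restarts
the growth. The a_n stay bounded, so g is entire, and running through approximations to a dense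
sequence makes the orbit dense. -/

/-- The numbers `c_n` for which `M^n (f, g) = c_n g^{(n)}`, where `M (f, g) = f(0) g'`, in terms
of `s = f(0)` and of the derivatives `a_n = g^{(n)}(0)`. -/
def orbitCoeff (s : ℂ) (a : ℕ → ℂ) : ℕ → ℂ
  | 0 => 1
  | 1 => s
  | n + 2 => orbitCoeff s a n * a n * orbitCoeff s a (n + 1)

/-! ### Decay and growth of the orbit coefficients -/

section OrbitCoeff

theorem orbitCoeff_congr {s : ℂ} {a a' : ℕ → ℂ} :
    ∀ {n : ℕ}, (∀ j, j + 2 ≤ n → a j = a' j) → orbitCoeff s a n = orbitCoeff s a' n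
  | 0, _ => rfl
  | 1, _ => rfl
  | n + 2, h => by
    have h1 : orbitCoeff s a n = orbitCoeff s a' n :=
      orbitCoeff_congr fun j hj => h j (by omega)
    have h2 : orbitCoeff s a (n + 1) = orbitCoeff s a' (n + 1) :=
      orbitCoeff_congr fun j hj => h j (by omega)
    simp only [orbitCoeff, h1, h2, h n le_rfl]

/-- The factorial in c_n cancels the one allowed for a_n, leaving 1/(3(n+2)(n+3)!) ≤ 1/(n+4)! in the
inductive step. The constants are sharp at index 2, where (1/3)(1/2) = 1/3!. -/
theorem norm_orbitCoeff_le {s : ℂ} {a : ℕ → ℂ} (hs : ‖s‖ ≤ 1 / 2)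
    (ha : ∀ n, ‖a n‖ ≤ n.factorial * (1 / 3)) :
    ∀ n, ‖orbitCoeff s a n‖ ≤ 1 / (n + 1).factorial
  | 0 => by simp [orbitCoeff]
  | 1 => by simpa [orbitCoeff] using hs
  | 2 => by
    have h0 := ha 0
    simp only [orbitCoeff, one_mul, norm_mul]
    calc ‖a 0‖ * ‖s‖ ≤ (1 / 3) * (1 / 2) := by
          gcongr
          simpa using h0
      _ = _ := by norm_num [Nat.factorial]
  | n + 3 => by
    have h1 := norm_orbitCoeff_le hs ha (n + 1)
    have h2 := norm_orbitCoeff_le hs ha (n + 2)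
    simp only [orbitCoeff] at h2 ⊢
    rw [norm_mul, norm_mul]
    calc _ ≤ 1 / ((n + 1 + 1).factorial : ℝ) * ((n + 1).factorial * (1 / 3)) *
          (1 / ((n + 2 + 1).factorial : ℝ)) := by
          gcongr
          exact ha _
      _ ≤ _ := by
          have e1 : ((n + 1 + 1).factorial : ℝ) = (n + 2) * (n + 1).factorial := by
            rw [Nat.factorial_succ]; push_cast; ring
          have e2 : ((n + 3 + 1).factorial : ℝ) = (n + 4) * (n + 2 + 1).factorial := by
            rw [Nat.factorial_succ]; push_cast; ring
          have p1 : (0 : ℝ) < (n + 1).factorial := by positivity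
          have p2 : (0 : ℝ) < (n + 2 + 1).factorial := by positivity
          rw [e1, e2]
          have : 1 / (((n : ℝ) + 2) * (n + 1).factorial) * ((n + 1).factorial * (1 / 3)) *
              (1 / ((n + 2 + 1).factorial : ℝ)) =
              1 / ((3 * n + 6) * (n + 2 + 1).factorial) := by
            field_simp
            ring
          rw [this]
          refine one_div_le_one_div_of_le (by positivity)
            (mul_le_mul_of_nonneg_right ?_ p2.le)
          linarith [(Nat.cast_nonneg n : (0 : ℝ) ≤ n)]

theorem orbitCoeff_ne_zero {s : ℂ} {a : ℕ → ℂ} (hs : s ≠ 0) (ha : ∀ n, a n ≠ 0) :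
    ∀ n, orbitCoeff s a n ≠ 0
  | 0 => one_ne_zero
  | 1 => hs
  | n + 2 => mul_ne_zero (mul_ne_zero (orbitCoeff_ne_zero hs ha n) (ha n))
      (orbitCoeff_ne_zero hs ha (n + 1))

/-- Once |c_n| η ≥ 2, the recursion gives |c_{n+2}| ≥ 2 |c_{n+1}|. Two consecutive coefficients
above 2/η therefore start a geometric growth that maintains itself. -/
theorem tendsto_norm_orbitCoeff_of_eventually_const {s : ℂ} {a : ℕ → ℂ} {η : ℝ} (hη : 0 < η)
    {L : ℕ} (ha : ∀ n, L ≤ n → a n = η) (h0 : 2 / η ≤ ‖orbitCoeff s a L‖)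
    (h1 : 2 / η ≤ ‖orbitCoeff s a (L + 1)‖) :
    Tendsto (fun n => ‖orbitCoeff s a n‖) atTop atTop := by
  have key : ∀ k : ℕ, 2 / η ≤ ‖orbitCoeff s a (L + k)‖ ∧
      2 ^ k * (2 / η) ≤ ‖orbitCoeff s a (L + 1 + k)‖ := by
    intro k
    induction k with
    | zero => simpa using ⟨h0, h1⟩
    | succ k ih =>
      obtain ⟨i1, i2⟩ := ih
      have e : L + 1 + k = L + (k + 1) := by ring
      have hp : (0 : ℝ) < 2 / η := by positivity
      refine ⟨?_, ?_⟩
      · rw [← e]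
        exact le_trans (le_mul_of_one_le_left hp.le (one_le_pow₀ one_le_two)) i2
      · have e2 : L + 1 + (k + 1) = L + k + 2 := by ring
        rw [e2, orbitCoeff, ha _ (Nat.le_add_right _ _), norm_mul, norm_mul, Complex.norm_real,
          Real.norm_of_nonneg hη.le]
        have e3 : L + k + 1 = L + 1 + k := by ring
        rw [e3]
        have : 2 ≤ ‖orbitCoeff s a (L + k)‖ * η := by
          rwa [div_le_iff₀ hη] at i1
        calc (2 : ℝ) ^ (k + 1) * (2 / η) = 2 * (2 ^ k * (2 / η)) := by ring
          _ ≤ _ := by gcongr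
  refine (tendsto_add_atTop_iff_nat (L + 1)).1 ?_
  have hlim : Tendsto (fun k : ℕ => (2 : ℝ) ^ k * (2 / η)) atTop atTop :=
    (tendsto_pow_atTop_atTop_of_one_lt one_lt_two).atTop_mul_const (by positivity)
  refine tendsto_atTop_mono (fun k => ?_) hlim
  rw [add_comm k]
  exact (key k).2

/-- As a function of T, the coefficient is a nonzero constant times a positive (Fibonacci) power of
T. The index starts at 1 because c_0 = 1 does not depend on T. -/
theorem tendsto_norm_orbitCoeff_param {b : ℕ → ℂ} (hb : ∀ n, b n ≠ 0) :
    ∀ n, Tendsto (fun T : ℝ => ‖orbitCoeff T b (n + 1)‖) atTop atTop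
  | 0 => by
    simp only [orbitCoeff, Complex.norm_real]
    exact tendsto_norm_atTop_atTop
  | 1 => by
    simp only [orbitCoeff, one_mul, norm_mul, Complex.norm_real]
    exact tendsto_norm_atTop_atTop.const_mul_atTop (norm_pos_iff.2 (hb 0))
  | n + 2 => by
    have h1 := tendsto_norm_orbitCoeff_param hb n
    have h2 := tendsto_norm_orbitCoeff_param hb (n + 1)
    have h3 := (h1.atTop_mul_const (norm_pos_iff.2 (hb (n + 1)))).atTop_mul_atTop₀ h2
    refine h3.congr fun T => ?_
    rw [← norm_mul, ← norm_mul]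
    rfl

/-- Scaling symmetry: dividing the entries by c = c_N multiplies the coefficients by c, since (c
x)(b / c)(c y) = c (x b y). The ratio T = c_{N+1} / c_N plays the role of the initial value s. -/
theorem orbitCoeff_add {s : ℂ} {a b : ℕ → ℂ} {N d : ℕ} {T : ℂ} (hc : orbitCoeff s a N ≠ 0)
    (hT : orbitCoeff s a (N + 1) = orbitCoeff s a N * T)
    (hb : ∀ j ≤ d, a (N + j) = b j / orbitCoeff s a N) :
    ∀ j ≤ d + 2, orbitCoeff s a (N + j) = orbitCoeff s a N * orbitCoeff T b j
  | 0, _ => by simp [orbitCoeff]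
  | 1, _ => by simpa [orbitCoeff] using hT
  | j + 2, hj => by
    have h1 := orbitCoeff_add hc hT hb j (by omega)
    have h2 := orbitCoeff_add hc hT hb (j + 1) (by omega)
    have : orbitCoeff s a (N + (j + 2)) =
      orbitCoeff s a (N + j) * a (N + j) * orbitCoeff s a (N + (j + 1)) := rfl
    rw [this, h1, h2, hb j (by omega)]
    simp only [orbitCoeff]
    field_simp

/-! ### Inductive construction of the Taylor coefficients -/

/-- A sequence that is a positive constant `tail` from `len` on, and whose orbit coefficients
tend to infinity: a stage of the construction of the Taylor coefficients of a hypercyclic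
vector. -/
structure Stage where
  seq : ℕ → ℂ
  len : ℕ
  tail : ℝ
  tail_pos : 0 < tail
  seq_ne_zero : ∀ n, seq n ≠ 0
  seq_eq_tail : ∀ n, len ≤ n → seq n = tail
  tendsto_coeff : Tendsto (fun n => ‖orbitCoeff 1 seq n‖) atTop atTop

/-- The stage `t` prolongs `s`, and the new entries realize the block `b 0, …, b d` up to the
factor `orbitCoeff 1 t.seq N`, the later entries being of size at most `ε` up to this factor. -/
structure Stage.Extends (s t : Stage) (b : ℕ → ℂ) (d : ℕ) (ε : ℝ) : Prop where
  len_lt : s.len < t.len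
  tail_le : t.tail ≤ s.tail
  seq_eq : ∀ n, n < s.len → t.seq n = s.seq n
  norm_le : ∀ n, s.len ≤ n → ‖t.seq n‖ ≤ s.tail
  block : ∃ N, N + d + 1 = t.len ∧
    (∀ j ≤ d, orbitCoeff 1 t.seq N * t.seq (N + j) = b j) ∧
    ‖orbitCoeff 1 t.seq N‖ * t.tail ≤ ε

/-- The single entry T / c_m placed before the block makes c_{m+2} = T c_{m+1}. A large T then lifts
the two coefficients after the block above the growth threshold of the new, smaller tail. T depends
only on the block and ε, so m can be chosen afterwards, large enough to make all new entries small.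
-/
theorem Stage.exists_extends (s : Stage) {b : ℕ → ℂ} (hb : ∀ n, b n ≠ 0) (d : ℕ) {ε : ℝ}
    (hε : 0 < ε) : ∃ t : Stage, s.Extends t b d ε := by
  obtain ⟨T, hT0, hT1, hT2⟩ : ∃ T : ℝ, 0 < T ∧ 2 / ε ≤ ‖orbitCoeff T b (d + 1)‖ ∧
      2 / ε ≤ ‖orbitCoeff T b (d + 2)‖ :=
    ((eventually_gt_atTop 0).and
      (((tendsto_norm_orbitCoeff_param hb d).eventually_ge_atTop _).and
        ((tendsto_norm_orbitCoeff_param hb (d + 1)).eventually_ge_atTop _))).exists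
  set B : ℝ := ∑ j ∈ Finset.range (d + 1), ‖b j‖ with hB
  -- The three lower bounds keep, in turn, the entry T / u, the new tail ε / ‖v‖ and the block
  -- entries b j / v below the old tail.
  obtain ⟨m, hm, hm1, hm2, hm3⟩ : ∃ m, s.len ≤ m ∧ T / s.tail ≤ ‖orbitCoeff 1 s.seq m‖ ∧
      ε / s.tail ≤ ‖orbitCoeff 1 s.seq (m + 1)‖ ∧ B / s.tail ≤ ‖orbitCoeff 1 s.seq (m + 1)‖ := by
    have h1 := (tendsto_add_atTop_iff_nat 1).2 s.tendsto_coeff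
    exact ((eventually_ge_atTop _).and ((s.tendsto_coeff.eventually_ge_atTop _).and
      ((h1.eventually_ge_atTop _).and (h1.eventually_ge_atTop _)))).exists
  have hη := s.tail_pos
  have hc0 := orbitCoeff_ne_zero one_ne_zero s.seq_ne_zero m
  have hc1 := orbitCoeff_ne_zero one_ne_zero s.seq_ne_zero (m + 1)
  set u := orbitCoeff 1 s.seq m with hu
  set v := orbitCoeff 1 s.seq (m + 1) with hv
  have hu0 : 0 < ‖u‖ := norm_pos_iff.2 hc0
  have hv0 : 0 < ‖v‖ := norm_pos_iff.2 hc1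
  have hTC : (T : ℂ) ≠ 0 := by exact_mod_cast hT0.ne'
  set η' : ℝ := ε / ‖v‖ with hη'
  have hη'0 : 0 < η' := by positivity
  have hη'C : (η' : ℂ) ≠ 0 := by exact_mod_cast hη'0.ne'
  have hle : η' ≤ s.tail := by
    rw [hη', div_le_iff₀ hv0]
    rwa [div_le_iff₀ hη, mul_comm] at hm2
  -- Layout: the old sequence up to m, the adjusting entry at m, the scaled block from N = m + 1,
  -- then the new constant tail.
  set a : ℕ → ℂ := fun n => if n < m then s.seq n else if n = m then T / u
    else if n < m + 1 + (d + 1) then b (n - (m + 1)) / v else η' with ha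
  have a1 : ∀ n, n < m → a n = s.seq n := fun n hn => by simp [ha, hn]
  have a2 : a m = T / u := by simp [ha]
  have a3 : ∀ j, j ≤ d → a (m + 1 + j) = b j / v := fun j hj => by
    have e1 : ¬ (m + 1 + j < m) := by omega
    have e2 : ¬ (m + 1 + j = m) := by omega
    have e3 : m + 1 + j < m + 1 + (d + 1) := by omega
    simp only [ha, e1, e2, e3, if_true, if_false, Nat.add_sub_cancel_left]
  have a4 : ∀ n, m + 1 + (d + 1) ≤ n → a n = η' := fun n hn => by
    have e1 : ¬ (n < m) := by omega
    have e2 : ¬ (n = m) := by omega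
    have e3 : ¬ (n < m + 1 + (d + 1)) := by omega
    simp only [ha, e1, e2, e3, if_false]
  have cases (n : ℕ) : n < m ∨ n = m ∨ (∃ j ≤ d, n = m + 1 + j) ∨ m + 1 + (d + 1) ≤ n := by
    rcases lt_trichotomy n m with h | h | h
    · exact Or.inl h
    · exact Or.inr (Or.inl h)
    · by_cases h' : n < m + 1 + (d + 1)
      · exact Or.inr (Or.inr (Or.inl ⟨n - (m + 1), by omega, by omega⟩))
      · exact Or.inr (Or.inr (Or.inr (by omega)))
  have cm : orbitCoeff 1 a m = u := orbitCoeff_congr fun j hj => a1 j (by omega)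
  have cm1 : orbitCoeff 1 a (m + 1) = v := orbitCoeff_congr fun j hj => a1 j (by omega)
  have cm2 : orbitCoeff 1 a (m + 1 + 1) = v * T := by
    rw [show m + 1 + 1 = m + 2 from rfl, orbitCoeff, cm, cm1, a2]
    field_simp
  have cadd := orbitCoeff_add (s := 1) (a := a) (b := b) (N := m + 1) (d := d) (T := T)
    (by rwa [cm1]) (by rw [cm1, cm2]) (by rwa [cm1])
  rw [cm1] at cadd
  -- The scaling by v turns the threshold 2 / ε for the block into the threshold 2 / η' for the new
  -- tail.
  have growth {x : ℂ} (hx : 2 / ε ≤ ‖x‖) : 2 / η' ≤ ‖v * x‖ := by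
    rw [norm_mul, hη']
    calc 2 / (ε / ‖v‖) = ‖v‖ * (2 / ε) := by field_simp
      _ ≤ _ := by gcongr
  refine ⟨⟨a, m + 1 + (d + 1), η', hη'0, fun n => ?_, a4,
    tendsto_norm_orbitCoeff_of_eventually_const hη'0 a4 ?_ ?_⟩, ⟨?_, hle, ?_, ?_, ?_⟩⟩
  · rcases cases n with h | rfl | ⟨j, hj, rfl⟩ | h
    · rw [a1 n h]; exact s.seq_ne_zero n
    · rw [a2]; exact div_ne_zero hTC hc0
    · rw [a3 j hj]; exact div_ne_zero (hb j) hc1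
    · rwa [a4 n h]
  · rw [cadd _ (by omega)]
    exact growth hT1
  · rw [show m + 1 + (d + 1) + 1 = m + 1 + (d + 2) from rfl, cadd _ le_rfl]
    exact growth hT2
  · simp only; omega
  · intro n hn
    exact a1 n (by omega)
  · intro n hn
    simp only
    rcases cases n with h | rfl | ⟨j, hj, rfl⟩ | h
    · rw [a1 n h, s.seq_eq_tail n hn, Complex.norm_real, Real.norm_of_nonneg hη.le]
    · rw [a2, norm_div, Complex.norm_real, Real.norm_of_nonneg hT0.le, div_le_iff₀ hu0]
      rwa [div_le_iff₀ hη, mul_comm] at hm1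
    · rw [a3 j hj, norm_div, div_le_iff₀ hv0]
      rw [div_le_iff₀ hη, mul_comm] at hm3
      refine le_trans ?_ hm3
      exact Finset.single_le_sum (f := fun j => ‖b j‖) (fun i _ => norm_nonneg _)
        (Finset.mem_range.2 (by omega))
    · rw [a4 n h, Complex.norm_real, Real.norm_of_nonneg hη'0.le]
      exact hle
  · refine ⟨m + 1, rfl, fun j hj => ?_, ?_⟩
    · simp only
      rw [cm1, a3 j hj]
      field_simp
    · simp only
      rw [cm1, hη']
      exact le_of_eq (by field_simp)

/-- The constant sequence `2`. -/
noncomputable def Stage.initial : Stage where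
  seq _ := 2
  len := 0
  tail := 2
  tail_pos := two_pos
  seq_ne_zero _ := two_ne_zero
  seq_eq_tail _ _ := by norm_num
  -- With tail 2 the threshold 2 / η equals 1, which is already the value of c_0 and c_1.
  tendsto_coeff := tendsto_norm_orbitCoeff_of_eventually_const (L := 0) two_pos
    (fun _ _ => by norm_num) (by norm_num [orbitCoeff]) (by norm_num [orbitCoeff])

/-- There is a bounded sequence whose shifts, multiplied by its orbit coefficients, realize
countably many prescribed finite blocks, followed by small entries. -/
theorem exists_seq_realizing_blocks {b : ℕ → ℕ → ℂ} (hb : ∀ k n, b k n ≠ 0) (d : ℕ → ℕ)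
    {ε : ℕ → ℝ} (hε : ∀ k, 0 < ε k) :
    ∃ a : ℕ → ℂ, (∀ n, ‖a n‖ ≤ 2) ∧ ∀ k, ∃ N,
      (∀ j ≤ d k, orbitCoeff 1 a N * a (N + j) = b k j) ∧
      ∀ j, d k < j → ‖orbitCoeff 1 a N * a (N + j)‖ ≤ ε k := by
  choose next hnext using fun (k : ℕ) (s : Stage) => s.exists_extends (hb k) (d k) (hε k)
  let S : ℕ → Stage := fun k => Nat.rec Stage.initial next k
  have hS (k : ℕ) : (S k).Extends (S (k + 1)) (b k) (d k) (ε k) := hnext k (S k)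
  have hmono : StrictMono fun k => (S k).len := strictMono_nat_of_lt_succ fun k => (hS k).len_lt
  have hanti : Antitone fun k => (S k).tail := antitone_nat_of_succ_le fun k => (hS k).tail_le
  have hagree (i n : ℕ) (hn : n < (S i).len) : ∀ k, i ≤ k → (S k).seq n = (S i).seq n := by
    intro k hk
    induction k, hk using Nat.le_induction with
    | base => rfl
    | succ k hk ih =>
      rw [(hS k).seq_eq n (hn.trans_le (hmono.monotone hk)), ih]
  have hsmall (i n : ℕ) (hn : (S i).len ≤ n) : ∀ k, i ≤ k → ‖(S k).seq n‖ ≤ (S i).tail := by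
    intro k hk
    induction k, hk using Nat.le_induction with
    | base =>
      rw [(S i).seq_eq_tail n hn, Complex.norm_real, Real.norm_of_nonneg (S i).tail_pos.le]
    | succ k hk ih =>
      by_cases h : n < (S k).len
      · rwa [(hS k).seq_eq n h]
      · exact ((hS k).norm_le n (not_lt.1 h)).trans (hanti hk)
  have hlen (n : ℕ) : n < (S (n + 1)).len := (Nat.lt_succ_self n).trans_le (hmono.le_apply)
  -- Diagonal limit: the length of stage n + 1 exceeds n, so entry n is frozen from that stage on.
  set a : ℕ → ℂ := fun n => (S (n + 1)).seq n with ha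
  have haS (k n : ℕ) (hn : n < (S k).len) : a n = (S k).seq n := by
    rw [ha]
    simp only
    rw [← hagree k n hn (max k (n + 1)) (le_max_left _ _),
      hagree (n + 1) n (hlen n) (max k (n + 1)) (le_max_right _ _)]
  have hatail (k n : ℕ) (hn : (S k).len ≤ n) : ‖a n‖ ≤ (S k).tail := by
    have h := hsmall k n hn (max k (n + 1)) (le_max_left _ _)
    rwa [hagree (n + 1) n (hlen n) _ (le_max_right _ _)] at h
  refine ⟨a, fun n => hatail 0 n (Nat.zero_le _), fun k => ?_⟩
  obtain ⟨N, hN, hN1, hN2⟩ := (hS k).block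
  have hcoeff : orbitCoeff 1 a N = orbitCoeff 1 (S (k + 1)).seq N :=
    orbitCoeff_congr fun j hj => haS (k + 1) j (by omega)
  refine ⟨N, fun j hj => ?_, fun j hj => ?_⟩
  · rw [hcoeff, haS (k + 1) _ (by omega), hN1 j hj]
  · rw [hcoeff, norm_mul]
    refine le_trans ?_ hN2
    gcongr
    exact hatail (k + 1) _ (by omega)

end OrbitCoeff

/-! ### Orbits of the operator and the open set of small pairs -/

namespace EntireFunctions

theorem coe_iterate_derivative (g : EntireFunctions) (n : ℕ) :
    ⇑(derivative^[n] g : C(ℂ, ℂ)) = iteratedDeriv n (g : C(ℂ, ℂ)) := by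
  induction n with
  | zero => simp
  | succ n ih =>
    rw [Function.iterate_succ_apply', iteratedDeriv_succ, ← ih]
    rfl

theorem derivative_iterate_smul (c : ℂ) (g : EntireFunctions) (n : ℕ) :
    derivative (c • derivative^[n] g) = c • derivative^[n + 1] g := by
  rw [derivative_smul, Function.iterate_succ_apply']

theorem hasSum_taylor (g : EntireFunctions) (z : ℂ) :
    HasSum (fun n : ℕ => iteratedDeriv n (g : C(ℂ, ℂ)) 0 * (z ^ n / n.factorial))
      ((g : C(ℂ, ℂ)) z) := by
  have h := Complex.hasSum_taylorSeries_of_entire g.2 0 z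
  refine h.congr_fun fun n => ?_
  simp only [smul_eq_mul, sub_zero]
  ring

theorem orbitSeq_evalMulDeriv_zero (x : Fin 2 → EntireFunctions) :
    orbitSeq evalMulDeriv x 0 = x 0 := by
  rw [orbitSeq]
  simp

/-- The shift by one reflects that the orbit starts with f at index 0 and g at index 1, so index n +
1 carries M^n. -/
theorem orbitSeq_evalMulDeriv (x : Fin 2 → EntireFunctions) :
    ∀ n, orbitSeq evalMulDeriv x (n + 1) =
      orbitCoeff ((x 0 : C(ℂ, ℂ)) 0) (fun j => iteratedDeriv j (x 1 : C(ℂ, ℂ)) 0) n •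
        derivative^[n] (x 1)
  | 0 => by
    rw [orbitSeq]
    simp [orbitCoeff]
  | 1 => by
    rw [orbitSeq]
    have h0 := orbitSeq_evalMulDeriv_zero x
    have h1 : orbitSeq evalMulDeriv x 1 = x 1 := by rw [orbitSeq]; simp
    rw [dif_neg (by norm_num)]
    change (orbitSeq evalMulDeriv x 0 : EntireFunctions).1 0 •
      derivative (orbitSeq evalMulDeriv x 1) = _
    rw [h0, h1]
    rfl
  | n + 2 => by
    have h0 := orbitSeq_evalMulDeriv x n
    have h1 := orbitSeq_evalMulDeriv x (n + 1)
    have hlt : ¬ n + 2 + 1 < 2 := by omega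
    rw [orbitSeq, dif_neg hlt]
    have e : n + 2 + 1 - 2 = n + 1 := by omega
    simp only [e]
    change (orbitSeq evalMulDeriv x (n + 1) : EntireFunctions).1 0 •
      derivative (orbitSeq evalMulDeriv x (n + 1 + 1)) = _
    rw [h0, h1, derivative_iterate_smul, smul_smul]
    congr 1
    simp only [orbitCoeff]
    rw [Submodule.coe_smul, ContinuousMap.smul_apply, coe_iterate_derivative, smul_eq_mul]

/-- Cauchy's estimates on the unit circle bound the derivatives by n!/3. The value at 0 is then at
most (1/(n+1)!) (n!/3) = 1/(3(n+1)). -/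
theorem norm_orbitSeq_apply_zero_le {x : Fin 2 → EntireFunctions}
    (h0 : ‖(x 0 : C(ℂ, ℂ)) 0‖ ≤ 1 / 2)
    (h1 : ∀ z ∈ Metric.closedBall (0 : ℂ) 1, ‖(x 1 : C(ℂ, ℂ)) z‖ ≤ 1 / 3) :
    ∀ k, ‖((orbitSeq evalMulDeriv x k : EntireFunctions) : C(ℂ, ℂ)) 0‖ ≤ 1 / 2
  | 0 => by rwa [orbitSeq_evalMulDeriv_zero]
  | n + 1 => by
    have ha (n : ℕ) : ‖iteratedDeriv n (x 1 : C(ℂ, ℂ)) 0‖ ≤ n.factorial * (1 / 3) := by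
      have h := Complex.norm_iteratedDeriv_le_of_forall_mem_sphere_norm_le n one_pos
        (Differentiable.diffContOnCl (x 1).2)
        (fun z hz => h1 z (Metric.sphere_subset_closedBall hz))
      simpa using h
    have hc := norm_orbitCoeff_le h0 ha n
    rw [orbitSeq_evalMulDeriv, Submodule.coe_smul, ContinuousMap.smul_apply,
      coe_iterate_derivative, smul_eq_mul, norm_mul]
    calc _ ≤ 1 / ((n + 1).factorial : ℝ) * (n.factorial * (1 / 3)) := by
          gcongr
          exact ha n
      _ = 1 / (3 * (n + 1)) := by
          have : (n.factorial : ℝ) ≠ 0 := by positivity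
          rw [Nat.factorial_succ]
          push_cast
          field_simp
      _ ≤ 1 / 2 := by
          refine one_div_le_one_div_of_le two_pos ?_
          linarith [(Nat.cast_nonneg n : (0 : ℝ) ≤ n)]

theorem continuous_eval (z : ℂ) : Continuous fun f : EntireFunctions => (f : C(ℂ, ℂ)) z :=
  (continuous_eval_const (F := C(ℂ, ℂ)) z).comp continuous_subtype_val

/-- Pairs of entire functions with small orbits. -/
def smallPairs : Set (Fin 2 → EntireFunctions) :=
  {x | ‖(x 0 : C(ℂ, ℂ)) 0‖ < 1 / 2} ∩
    {x | Set.MapsTo (x 1 : C(ℂ, ℂ)) (Metric.closedBall 0 1) (Metric.ball 0 (1 / 3))}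

theorem isOpen_smallPairs : IsOpen smallPairs := by
  refine IsOpen.inter ?_ ?_
  · exact isOpen_lt ((continuous_eval 0).comp (continuous_apply 0)).norm continuous_const
  · exact (ContinuousMap.isOpen_setOfPred_mapsTo (isCompact_closedBall (0 : ℂ) 1)
      Metric.isOpen_ball).preimage (continuous_subtype_val.comp (continuous_apply 1))

theorem zero_mem_smallPairs : (0 : Fin 2 → EntireFunctions) ∈ smallPairs := by
  refine ⟨by simp, fun _ _ => by simp⟩

theorem norm_orbitSeq_apply_zero_le_of_mem {x : Fin 2 → EntireFunctions} (hx : x ∈ smallPairs)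
    (k : ℕ) : ‖((orbitSeq evalMulDeriv x k : EntireFunctions) : C(ℂ, ℂ)) 0‖ ≤ 1 / 2 :=
  norm_orbitSeq_apply_zero_le hx.1.le (fun _ hz => (mem_ball_zero_iff.1 (hx.2 hz)).le) k

/-- The entire functions of modulus larger than `1 / 2` at the origin. -/
def largeAtZero : Set EntireFunctions := {f | 1 / 2 < ‖(f : C(ℂ, ℂ)) 0‖}

theorem isOpen_largeAtZero : IsOpen largeAtZero :=
  isOpen_lt continuous_const (continuous_eval 0).norm

/-- The constant function `1`. -/
noncomputable def constOne : EntireFunctions := ⟨ContinuousMap.const ℂ 1, differentiable_const (1 : ℂ)⟩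

theorem constOne_apply (z : ℂ) : (constOne : C(ℂ, ℂ)) z = 1 := rfl

theorem nonempty_largeAtZero : largeAtZero.Nonempty :=
  ⟨constOne, by norm_num [largeAtZero, constOne_apply]⟩

theorem not_isStronglyTransitive_evalMulDeriv : ¬ IsStronglyTransitive evalMulDeriv := by
  intro h
  obtain ⟨n, -, f, ⟨x, hx, rfl⟩, hf⟩ := h smallPairs largeAtZero isOpen_smallPairs
    ⟨0, zero_mem_smallPairs⟩ isOpen_largeAtZero nonempty_largeAtZero
  exact (norm_orbitSeq_apply_zero_le_of_mem hx _).not_gt hf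

theorem not_isHypercyclicVector_of_mem_smallPairs {x : Fin 2 → EntireFunctions}
    (hx : x ∈ smallPairs) : ¬ IsHypercyclicVector evalMulDeriv x := by
  intro h
  obtain ⟨f, hf, k, rfl⟩ := h.inter_open_nonempty _ isOpen_largeAtZero nonempty_largeAtZero
  exact (norm_orbitSeq_apply_zero_le_of_mem hx k).not_gt hf

/-! ### Entire functions with prescribed bounded derivatives at 0 -/

theorem summable_mul_pow_div_factorial {a : ℕ → ℂ} {K : ℝ} (ha : ∀ n, ‖a n‖ ≤ K) (z : ℂ) :
    Summable fun n : ℕ => a n * (z ^ n / n.factorial) := by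
  refine Summable.of_norm_bounded ((Real.summable_pow_div_factorial ‖z‖).mul_left K)
    fun n => ?_
  rw [norm_mul, norm_div, norm_pow, Complex.norm_natCast]
  gcongr
  exact ha n

/-- Differentiation shifts the sequence a. Termwise differentiation is justified on the ball of
radius ‖z‖ + 1, where a shifted exponential series dominates. -/
theorem hasDerivAt_tsum_mul_pow_div_factorial {a : ℕ → ℂ} {K : ℝ} (ha : ∀ n, ‖a n‖ ≤ K)
    (z : ℂ) : HasDerivAt (fun z : ℂ => ∑' n : ℕ, a n * (z ^ n / n.factorial))
      (∑' n : ℕ, a (n + 1) * (z ^ n / n.factorial)) z := by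
  have hK : 0 ≤ K := (norm_nonneg _).trans (ha 0)
  have hder (n : ℕ) (y : ℂ) : HasDerivAt (fun y : ℂ => a n * (y ^ n / n.factorial))
      (a n * (n * y ^ (n - 1) / n.factorial)) y :=
    ((hasDerivAt_pow n y).div_const _).const_mul _
  have hsucc (n : ℕ) (y : ℂ) :
      a (n + 1) * (((n + 1 : ℕ) : ℂ) * y ^ (n + 1 - 1) / (n + 1).factorial) =
        a (n + 1) * (y ^ n / n.factorial) := by
    have : (n.factorial : ℂ) ≠ 0 := by exact_mod_cast n.factorial_ne_zero
    have h2 : (n : ℂ) + 1 ≠ 0 := by exact_mod_cast n.succ_ne_zero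
    rw [Nat.factorial_succ, Nat.add_sub_cancel]
    push_cast
    field_simp
  set R : ℝ := ‖z‖ + 1 with hR
  let u : ℕ → ℝ := fun n => K * (n * R ^ (n - 1) / n.factorial)
  have hu : Summable u := by
    refine (summable_nat_add_iff 1).1 ?_
    refine ((Real.summable_pow_div_factorial R).mul_left K).congr fun n => ?_
    simp only [u]
    have : (n.factorial : ℝ) ≠ 0 := by positivity
    rw [Nat.factorial_succ, Nat.add_sub_cancel]
    push_cast
    field_simp
  have hzR : z ∈ Metric.ball (0 : ℂ) R := by simp [hR]
  have key := hasDerivAt_tsum_of_isPreconnected (t := Metric.ball (0 : ℂ) R) hu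
    Metric.isOpen_ball (convex_ball _ _).isPreconnected (fun n y _ => hder n y)
    (fun n y hy => ?_) hzR (summable_mul_pow_div_factorial ha z) hzR
  · have hsum : ∑' n : ℕ, a (n + 1) * (z ^ n / n.factorial) =
        ∑' n : ℕ, a n * (n * z ^ (n - 1) / n.factorial) := ?_
    · rwa [hsum]
    rw [Summable.tsum_eq_zero_add (f := fun n : ℕ => a n * (n * z ^ (n - 1) / n.factorial))]
    · simp only [hsucc]
      simp
    · refine (summable_nat_add_iff 1).1 ?_
      simp only [hsucc]
      exact summable_mul_pow_div_factorial (fun n => ha (n + 1)) z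
  · simp only [u]
    rw [norm_mul, norm_div, norm_mul, norm_pow, Complex.norm_natCast, Complex.norm_natCast]
    have hy' : ‖y‖ ≤ R := (mem_ball_zero_iff.1 hy).le
    gcongr
    exact ha n

theorem exists_iteratedDeriv_zero_eq {a : ℕ → ℂ} {K : ℝ} (ha : ∀ n, ‖a n‖ ≤ K) :
    ∃ g : EntireFunctions, ∀ n, iteratedDeriv n (g : C(ℂ, ℂ)) 0 = a n := by
  have hd : Differentiable ℂ fun z : ℂ => ∑' n : ℕ, a n * (z ^ n / n.factorial) :=
    fun z => (hasDerivAt_tsum_mul_pow_div_factorial ha z).differentiableAt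
  refine ⟨⟨⟨_, hd.continuous⟩, hd⟩, fun n => ?_⟩
  have key : ∀ n, iteratedDeriv n (fun z : ℂ => ∑' n : ℕ, a n * (z ^ n / n.factorial)) =
      fun z : ℂ => ∑' k : ℕ, a (n + k) * (z ^ k / k.factorial) := by
    intro n
    induction n with
    | zero => simp
    | succ n ih =>
      rw [iteratedDeriv_succ, ih]
      funext z
      rw [(hasDerivAt_tsum_mul_pow_div_factorial (fun k => ha (n + k)) z).deriv]
      simp only [add_assoc, add_comm 1]
  refine (congrFun (key n) 0).trans ?_
  rw [tsum_eq_single 0 fun k hk => by simp [hk]]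
  simp

/-- An entire function is close to another one on a disc if its first Taylor coefficients are
close, the later ones are small, and the Taylor series of the other one has a small tail. -/
theorem norm_sub_le_of_taylor {f h : EntireFunctions} {d : ℕ} {ε R : ℝ}
    (h1 : ∀ j ≤ d, ‖iteratedDeriv j (f : C(ℂ, ℂ)) 0 - iteratedDeriv j (h : C(ℂ, ℂ)) 0‖ ≤ ε)
    (h2 : ∀ j, d < j → ‖iteratedDeriv j (f : C(ℂ, ℂ)) 0‖ ≤ ε)
    (h3 : ∑' j : ℕ, ‖iteratedDeriv (j + (d + 1)) (h : C(ℂ, ℂ)) 0‖ *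
      (R ^ (j + (d + 1)) / (j + (d + 1)).factorial) ≤ ε) {z : ℂ} (hz : ‖z‖ ≤ R) :
    ‖(f : C(ℂ, ℂ)) z - (h : C(ℂ, ℂ)) z‖ ≤ ε * (Real.exp R + 1) := by
  have hR : 0 ≤ R := (norm_nonneg z).trans hz
  set p : ℕ → ℂ := fun j => iteratedDeriv j (f : C(ℂ, ℂ)) 0
  set q : ℕ → ℂ := fun j => iteratedDeriv j (h : C(ℂ, ℂ)) 0
  set w : ℕ → ℝ := fun j => R ^ j / j.factorial with hw
  have hε : 0 ≤ ε := (norm_nonneg _).trans (h2 (d + 1) (Nat.lt_succ_self d))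
  have hq : Summable fun j => ‖q j‖ * w j := by
    have := (hasSum_taylor h R).summable.norm
    refine this.congr fun j => ?_
    rw [norm_mul, norm_div, norm_pow, Complex.norm_natCast, Complex.norm_real,
      Real.norm_of_nonneg hR]
  have hexp : HasSum (fun j => ε * w j) (ε * Real.exp R) := by
    have : HasSum w (Real.exp R) := by
      rw [Real.exp_eq_exp_ℝ]
      exact NormedSpace.expSeries_div_hasSum_exp R
    exact this.mul_left ε
  have htail : HasSum (fun j => if j < d + 1 then 0 else ‖q j‖ * w j)
      (∑' j, ‖q (j + (d + 1))‖ * w (j + (d + 1))) := by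
    have := ((summable_nat_add_iff (d + 1)).2 hq).hasSum
    have h4 := (hasSum_nat_add_iff (f := fun j => if j < d + 1 then 0 else ‖q j‖ * w j)
      (g := ∑' j, ‖q (j + (d + 1))‖ * w (j + (d + 1))) (d + 1)).1
      (this.congr_fun fun j => if_neg (by omega))
    rw [Finset.sum_eq_zero fun j hj => by simp [Finset.mem_range.1 hj], add_zero] at h4
    exact h4
  have hsub := (hasSum_taylor f z).sub (hasSum_taylor h z)
  -- Up to d the coefficient difference costs ε; beyond d the coefficient of f costs ε and that of h
  -- goes into its Taylor tail. Summing the ε terms gives ε exp R.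
  have hle (j : ℕ) : ‖p j * (z ^ j / j.factorial) - q j * (z ^ j / j.factorial)‖ ≤
      ε * w j + if j < d + 1 then 0 else ‖q j‖ * w j := by
    have hzw : ‖z ^ j / (j.factorial : ℂ)‖ ≤ w j := by
      rw [norm_div, norm_pow, Complex.norm_natCast]
      simp only [hw]
      gcongr
    rw [← sub_mul, norm_mul]
    split_ifs with hj
    · rw [add_zero]
      exact mul_le_mul (h1 j (by omega)) hzw (norm_nonneg _) hε
    · rw [← add_mul]
      refine mul_le_mul ?_ hzw (norm_nonneg _) (by positivity)
      exact (norm_sub_le _ _).trans (add_le_add_left (h2 j (by omega)) _)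
  calc _ ≤ ε * Real.exp R + ∑' j, ‖q (j + (d + 1))‖ * w (j + (d + 1)) :=
        hsub.norm_le_of_bounded (hexp.add htail) hle
    _ ≤ ε * Real.exp R + ε := by gcongr
    _ = _ := by ring

theorem exists_taylor_tail_le (h : EntireFunctions) (R : ℝ) {ε : ℝ} (hε : 0 < ε) :
    ∃ d : ℕ, ∑' j : ℕ, ‖iteratedDeriv (j + (d + 1)) (h : C(ℂ, ℂ)) 0‖ *
      (R ^ (j + (d + 1)) / (j + (d + 1)).factorial) ≤ ε := by
  have h1 := tendsto_sum_nat_add fun j : ℕ => ‖iteratedDeriv j (h : C(ℂ, ℂ)) 0‖ *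
      (R ^ j / j.factorial)
  exact (((tendsto_add_atTop_iff_nat 1).2 h1).eventually_le_const hε).exists

end EntireFunctions

/-! ### The separable Fréchet space structure -/

namespace EntireFunctions

theorem iteratedDeriv_smul_iterate_derivative (c : ℂ) (g : EntireFunctions) (N j : ℕ) :
    iteratedDeriv j ((c • derivative^[N] g : EntireFunctions) : C(ℂ, ℂ)) 0 =
      c * iteratedDeriv (N + j) (g : C(ℂ, ℂ)) 0 := by
  have h : derivative^[j] (c • derivative^[N] g) = c • derivative^[N + j] g := by
    induction j with
    | zero => rfl
    | succ j ih => rw [Function.iterate_succ_apply', ih, derivative_iterate_smul, add_assoc]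
  rw [← coe_iterate_derivative, h, ← coe_iterate_derivative]
  rfl

instance : TopologicalSpace.SeparableSpace EntireFunctions := by
  have : SecondCountableTopology EntireFunctions :=
    TopologicalSpace.Subtype.secondCountableTopology (EntireFunctions : Set C(ℂ, ℂ))
  infer_instance

instance : IsUniformAddGroup C(ℂ, ℂ) :=
  let φ : C(ℂ, ℂ) →+ UniformOnFun ℂ ℂ {K | IsCompact K} :=
    { toFun := ContinuousMap.toUniformOnFunIsCompact
      map_zero' := rfl
      map_add' := fun _ _ => rfl }
  IsUniformInducing.isUniformAddGroup φ
    ContinuousMap.isUniformEmbedding_toUniformOnFunIsCompact.isUniformInducing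

instance : IsUniformAddGroup EntireFunctions :=
  IsUniformAddGroup.comap EntireFunctions.subtype

instance : (uniformity EntireFunctions).IsCountablyGenerated :=
  inferInstanceAs (comap _ _).IsCountablyGenerated

instance : TopologicalSpace.MetrizableSpace EntireFunctions :=
  UniformSpace.metrizableSpace

instance : LocallyConvexSpace ℝ EntireFunctions :=
  Topology.IsInducing.locallyConvexSpace (f := (EntireFunctions.subtype.restrictScalars ℝ))
    Topology.IsInducing.subtypeVal

/-- Weierstrass: locally uniform limits of holomorphic functions are holomorphic. -/
theorem isClosed : IsClosed (EntireFunctions : Set C(ℂ, ℂ)) := by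
  refine isClosed_of_closure_subset fun f hf => ?_
  obtain ⟨u, hu, hlim⟩ := mem_closure_iff_seq_limit.1 hf
  rw [ContinuousMap.tendsto_iff_tendstoLocallyUniformly, ← tendstoLocallyUniformlyOn_univ] at hlim
  exact differentiableOn_univ.1 (hlim.differentiableOn
    (Eventually.of_forall fun n => (hu n).differentiableOn) isOpen_univ)

instance : CompleteSpace EntireFunctions := isClosed.isComplete.completeSpace_coe

/-- By Baire's theorem a residual set is dense, so it would meet the open set of small pairs. -/
theorem hypercyclicVectors_notMem_residual :
    {x | IsHypercyclicVector evalMulDeriv x} ∉ residual (Fin 2 → EntireFunctions) := by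
  intro h
  obtain ⟨x, hx, hx'⟩ := (dense_of_mem_residual h).inter_open_nonempty _ isOpen_smallPairs
    ⟨0, zero_mem_smallPairs⟩
  exact not_isHypercyclicVector_of_mem_smallPairs hx hx'

/-! ### Density of the constructed orbit -/

theorem tendsto_of_norm_sub_le {ι : Type*} {l : Filter ι} {F : ι → EntireFunctions}
    {h : EntireFunctions} {R δ : ι → ℝ} (hR : Tendsto R l atTop) (hδ : Tendsto δ l (𝓝 0))
    (hF : ∀ i z, ‖z‖ ≤ R i → ‖(F i : C(ℂ, ℂ)) z - (h : C(ℂ, ℂ)) z‖ ≤ δ i) :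
    Tendsto F l (𝓝 h) := by
  rw [tendsto_subtype_rng, ContinuousMap.tendsto_iff_forall_isCompact_tendstoUniformlyOn]
  intro K hK
  obtain ⟨C, hC⟩ := hK.isBounded.exists_norm_le
  rw [Metric.tendstoUniformlyOn_iff]
  intro ε hε
  filter_upwards [hR.eventually_ge_atTop C, hδ.eventually_lt_const hε] with i h1 h2 z hz
  rw [dist_comm, dist_eq_norm]
  exact (hF i z ((hC z hz).trans h1)).trans_lt h2

theorem isHypercyclic_evalMulDeriv : IsHypercyclic evalMulDeriv := by
  obtain ⟨u, hu⟩ := TopologicalSpace.exists_dense_seq EntireFunctions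
  -- Unpairing repeats each u i at infinitely many k, so it is approximated on discs of radius k
  -- with error 1 / (k + 1).
  let h : ℕ → EntireFunctions := fun k => u k.unpair.1
  -- Chosen so that ε k * (exp k + 1) = 1 / (k + 1), the bound given by `norm_sub_le_of_taylor` with
  -- R = k.
  let ε : ℕ → ℝ := fun k => 1 / ((k + 1) * (Real.exp k + 1))
  have hε (k : ℕ) : 0 < ε k := by positivity
  choose d hd using fun k : ℕ => exists_taylor_tail_le (h k) k (hε k)
  let t : ℕ → ℕ → ℂ := fun k j => iteratedDeriv j (h k : C(ℂ, ℂ)) 0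
  -- Zero Taylor coefficients are perturbed because a vanishing entry would make all orbit
  -- coefficients from two indices later on vanish.
  let b : ℕ → ℕ → ℂ := fun k j => if t k j = 0 then ε k else t k j
  have hb (k j : ℕ) : b k j ≠ 0 := by
    simp only [b]
    split_ifs with h0
    · exact_mod_cast (hε k).ne'
    · exact h0
  have hbt (k j : ℕ) : ‖b k j - t k j‖ ≤ ε k := by
    simp only [b]
    split_ifs with h0
    · rw [h0, sub_zero, Complex.norm_real, Real.norm_of_nonneg (hε k).le]
    · simpa using (hε k).le
  obtain ⟨a, ha, hN⟩ := exists_seq_realizing_blocks hb d hε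
  choose N hN1 hN2 using hN
  obtain ⟨g, hg⟩ := exists_iteratedDeriv_zero_eq ha
  refine ⟨![constOne, g], ?_⟩
  have horbit (n : ℕ) : orbitSeq evalMulDeriv ![constOne, g] (n + 1) =
      orbitCoeff 1 a n • derivative^[n] g := by
    rw [orbitSeq_evalMulDeriv]
    simp only [Matrix.cons_val_zero, Matrix.cons_val_one, constOne_apply, hg]
  have hclose (k : ℕ) (z : ℂ) (hz : ‖z‖ ≤ k) :
      ‖((orbitSeq evalMulDeriv ![constOne, g] (N k + 1) : EntireFunctions) : C(ℂ, ℂ)) z -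
        (h k : C(ℂ, ℂ)) z‖ ≤ 1 / ((k : ℝ) + 1) := by
    have hle := norm_sub_le_of_taylor
      (f := orbitSeq evalMulDeriv ![constOne, g] (N k + 1)) (h := h k) (d := d k) (ε := ε k)
      (R := k) (fun j hj => ?_) (fun j hj => ?_) (hd k) hz
    · refine hle.trans (le_of_eq ?_)
      have : Real.exp k + 1 ≠ 0 := by positivity
      simp only [ε]
      field_simp
    · rw [horbit, iteratedDeriv_smul_iterate_derivative, hg, hN1 k j hj]
      exact hbt k j
    · rw [horbit, iteratedDeriv_smul_iterate_derivative, hg]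
      exact hN2 k j hj
  have hmem (i : ℕ) : u i ∈ closure (Set.range (orbitSeq evalMulDeriv ![constOne, g])) := by
    have hpair : Tendsto (fun m => Nat.pair i m) atTop atTop :=
      tendsto_atTop_mono (fun m => Nat.right_le_pair i m) tendsto_id
    refine mem_closure_of_tendsto (b := atTop)
      (f := fun m => orbitSeq evalMulDeriv ![constOne, g] (N (Nat.pair i m) + 1))
      (tendsto_of_norm_sub_le (R := fun m => (Nat.pair i m : ℝ))
        (δ := fun m => 1 / ((Nat.pair i m : ℝ) + 1))
        (tendsto_natCast_atTop_atTop.comp hpair)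
        (tendsto_one_div_add_atTop_nhds_zero_nat.comp hpair) fun m z hz => ?_)
      (Eventually.of_forall fun m => Set.mem_range_self _)
    have := hclose (Nat.pair i m) z hz
    simpa only [h, Nat.unpair_pair] using this
  exact dense_closure.1 (hu.mono (Set.range_subset_iff.2 hmem))

end EntireFunctions

theorem mainTheorem3 :
    IsHypercyclic EntireFunctions.evalMulDeriv ∧
    ¬ IsStronglyTransitive EntireFunctions.evalMulDeriv ∧
    {x | IsHypercyclicVector EntireFunctions.evalMulDeriv x} ∉
      residual (Fin 2 → EntireFunctions) ∧
    ¬ HypercyclicImpliesResidual :=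
  ⟨EntireFunctions.isHypercyclic_evalMulDeriv,
    EntireFunctions.not_isStronglyTransitive_evalMulDeriv,
    EntireFunctions.hypercyclicVectors_notMem_residual,
    fun h => EntireFunctions.hypercyclicVectors_notMem_residual
      (h EntireFunctions 2 EntireFunctions.evalMulDeriv one_le_two
        EntireFunctions.isHypercyclic_evalMulDeriv)⟩
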